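/- Work in a nonstandard extension given by an ultrapower along an ultrafilter $U$ on a set $J$, so that ${}^*X=X^J/U$; an internal function or an internal set is an element of ${}^*(Y^X)$ or ${}^*\mathcal P(X)$. Let $D\in\mathbb N$, let $N_0,\dots,N_D\in{}^*\mathbb N$ be unlimited, $\mathrm I_\iota=\{0,\frac1{N_\iota},\dots,\frac{N_\iota-1}{N_\iota},1\}$ and $\mathrm I=\mathrm I_0\times\dots\times\mathrm I_D\subset{}^*\mathbb R^{1+D}$. Let $\lambda$ be the product of the measures $\lambda_\iota$ that give mass $\frac1{N_\iota}$ to every point of $\mathrm I_\iota\setminus\{1\}$ (and none to $1$); integrals $\int_A f\,d\lambda$, with $A\subseteq\mathrm I$ and $f:\mathrm I\to{}^*\mathbb R$ internal, are hyperfinite sums. All functions are internal. Write $a\simeq b$ if $a-b$ is infinitesimal, coordinatewise for points of $\mathrm I$. The following notions are used on $\mathrm I$ and, likewise, on each $\mathrm I_\iota$. - $f$ is *$S$-integrable* if $\int_{\mathrm I}|f|\,d\lambda$ is limited and $\int_A|f|\,d\lambda\simeq0$ for every internal $A\subseteq\mathrm I$ with $\lambda(A)\simeq0$. - A possibly external set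 $R\subseteq\mathrm I$ is *rare* if for every standard $\varepsilon>0$ it is contained in an internal set $A$ with $\lambda(A)\le\varepsilon$. - $f$ is *$S$-continuous* on $S\subseteq\mathrm I$ if $f(x)\simeq f(y)$ for all $x,y\in S$ with $x\simeq y$. It is *Lebesgue integrable* if it is $S$-integrable and $S$-continuous on $\mathrm I\setminus R$ for some rare $R$. - An internal $A\subseteq\mathrm I$ is *quadrable* if its boundary, the set of the points of $\mathrm I$ infinitely close both to a point of $A$ and to a point of $\mathrm I\setminus A$, is rare. - $f$ is *fast oscillating* if it is $S$-integrable and $\int_A f\,d\lambda\simeq0$ for every quadrable $A$. - $\mathfrak n:\mathrm I\to{}^*\mathbb R$ is a *noise of mean* $m:\mathrm I\to{}^*\mathbb R$ if $m$ is Lebesgue integrable, $\mathfrak n$ is $S$-integrable and, for every $\iota$ and all $\xi_\kappa\in\mathrm I_\kappa$ ($\kappa\ne\iota$), the function $\xi_\iota\mapsto(\mathfrak n-m)(\xi_0,\dots,\xi_D)$ on $\mathrm I_\iota$ is fast oscillating. It is *zero-mean* if one can take $m\equiv0$. - $\varphi:\mathrm I\to{}^*\mathbb R$ is *of class $S^1$*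 if its values are limited and there are functions $g_0,\dots,g_D:\mathrm I\to{}^*\mathbb R$ with limited values, $S$-continuous on $\mathrm I$, such that for all $x\simeq y$ in $\mathrm I$ one has $\varphi(y)-\varphi(x)=\sum_\iota g_\iota(x)(y_\iota-x_\iota)+\eta\sum_\iota|y_\iota-x_\iota|$ with some $\eta\simeq0$. **Proposition.** Let $\varphi:\mathrm I\to{}^*\mathbb R$ be of class $S^1$. If $\mathfrak n$ is a noise of mean $m$, then $\varphi\mathfrak n$ is a noise of mean $\varphi m$. If $\mathfrak n$ is zero-mean, so is $\varphi\mathfrak n$. -/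

import Mathlib

open Filter

noncomputable section

namespace NonstandardNoise

/-- The nonstandard extension `*X` of a set `X`: the ultrapower of `X` along `U`.
`Star U ℝ` is the field of hyperreals; for `U = hyperfilter ℕ` it is Mathlib's `Hyperreal`.
Elements of `Star U (X → Y)` are the internal functions `*X → *Y`, and elements of
`Star U (Set X)` are the internal subsets of `*X`. -/
abbrev Star {J : Type*} (U : Ultrafilter J) (X : Type*) : Type _ := Germ (U : Filter J) X

variable {J : Type*} {U : Ultrafilter J} {σ : Type*} [Fintype σ] [DecidableEq σ]

/-- The value of an internal function at a point. -/
def app {X Y : Type*} (f : Star U (X → Y)) (x : Star U X) : Star U Y :=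
  Germ.map₂ (fun g y => g y) f x

/-- Membership of a point in an internal set. -/
def IMem {X : Type*} (x : Star U X) (A : Star U (Set X)) : Prop :=
  Germ.LiftRel (fun y B => y ∈ B) x A

/-- The embedding of `ℝ` in `*ℝ`. -/
def std (r : ℝ) : Star U ℝ := Germ.const r

/-- Limited hyperreals. -/
def IsLimited (a : Star U ℝ) : Prop := ∃ r : ℝ, |a| ≤ std r

/-- Infinitesimal hyperreals. -/
def IsInfinitesimal (a : Star U ℝ) : Prop := ∀ r : ℝ, 0 < r → |a| < std r

/-- Unlimited hypernatural numbers. -/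
def IsUnlimitedNat (a : Star U ℕ) : Prop := ∀ k : ℕ, (Germ.const k : Star U ℕ) < a

/-- The `i`-th coordinate of a tuple of nonstandard numbers: `*(K ^ σ) = (*K) ^ σ`. -/
def coord {K : Type*} (x : Star U (σ → K)) (i : σ) : Star U K := Germ.map (fun y => y i) x

/-- For standard `n`, the finite grid `∏ i, {0, 1 / n i, …, (n i - 1) / n i, 1}`. -/
def stdGrid (n : σ → ℕ) : Finset (σ → ℝ) :=
  Fintype.piFinset fun i => (Finset.range (n i + 1)).image fun k : ℕ => (k : ℝ) / (n i : ℝ)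

open Classical in
/-- For standard `n`, the integral over `A` of `f` against the product of the measures that give
mass `1 / n i` to every point of the `i`-th grid other than the right end point `1`. -/
def stdIntegral (n : σ → ℕ) (A : Set (σ → ℝ)) (f : (σ → ℝ) → ℝ) : ℝ :=
  ∑ x ∈ stdGrid n with (x ∈ A ∧ ∀ i, x i ≠ 1), f x * ∏ i, (1 / (n i : ℝ))

/-- The hyperfinite grid `I = ∏ i, {0, 1 / N i, …, (N i - 1) / N i, 1}`, as a set of points of
`*(ℝ ^ σ)`. -/
def grid (N : Star U (σ → ℕ)) : Set (Star U (σ → ℝ)) :=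
  {x | Germ.LiftRel (fun y n => y ∈ stdGrid n) x N}

/-- The integral `∫_A f dλ` of the internal function `f` over the internal set `A ∩ I`: a
hyperfinite sum. -/
def integral (N : Star U (σ → ℕ)) (A : Star U (Set (σ → ℝ))) (f : Star U ((σ → ℝ) → ℝ)) :
    Star U ℝ :=
  app (Germ.map₂ stdIntegral N A) f

/-- The Lebesgue measure `λ(A)` of the internal set `A ∩ I`. -/
def measure (N : Star U (σ → ℕ)) (A : Star U (Set (σ → ℝ))) : Star U ℝ :=
  integral N A (Germ.const fun _ => 1)

/-- The internal function `|f|`. -/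
def absFun {X : Type*} (f : Star U (X → ℝ)) : Star U (X → ℝ) := Germ.map (fun g x => |g x|) f

/-- `f` is S-integrable on `I`: `∫_I |f| dλ` is limited, and `∫_A |f| dλ` is infinitesimal for
every internal `A` of infinitesimal measure. -/
def SIntegrable (N : Star U (σ → ℕ)) (f : Star U ((σ → ℝ) → ℝ)) : Prop :=
  IsLimited (integral N (Germ.const Set.univ) (absFun f)) ∧
    ∀ A : Star U (Set (σ → ℝ)), IsInfinitesimal (measure N A) →
      IsInfinitesimal (integral N A (absFun f))

/-- The relation `x ≃ y` between points. -/
def Near (x y : Star U (σ → ℝ)) : Prop := ∀ i, IsInfinitesimal (coord x i - coord y i)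

/-- A (possibly external) set `R` of points is rare if, for every standard `ε > 0`, it is contained
in an internal set of measure at most `ε`. -/
def IsRare (N : Star U (σ → ℕ)) (R : Set (Star U (σ → ℝ))) : Prop :=
  ∀ ε : ℝ, 0 < ε → ∃ A : Star U (Set (σ → ℝ)), (∀ x ∈ R, IMem x A) ∧ measure N A ≤ std ε

/-- `f` is S-continuous on the set `S` of points. -/
def SContinuousOn (f : Star U ((σ → ℝ) → ℝ)) (S : Set (Star U (σ → ℝ))) : Prop :=
  ∀ x ∈ S, ∀ y ∈ S, Near x y → IsInfinitesimal (app f x - app f y)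

/-- `f` is Lebesgue integrable on `I`: it is S-integrable, and S-continuous on the complement in
`I` of some rare set. -/
def LebesgueIntegrable (N : Star U (σ → ℕ)) (f : Star U ((σ → ℝ) → ℝ)) : Prop :=
  SIntegrable N f ∧
    ∃ R : Set (Star U (σ → ℝ)), R ⊆ grid N ∧ IsRare N R ∧ SContinuousOn f (grid N \ R)

/-- The boundary in `I` of the internal set `A`: the points of `I` that are infinitely close both
to a point of `I` in `A` and to a point of `I` outside `A`. -/
def boundary (N : Star U (σ → ℕ)) (A : Star U (Set (σ → ℝ))) : Set (Star U (σ → ℝ)) :=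
  {x | x ∈ grid N ∧ (∃ y ∈ grid N, IMem y A ∧ Near x y) ∧ ∃ z ∈ grid N, ¬ IMem z A ∧ Near x z}

/-- An internal set is quadrable if its boundary is rare. -/
def IsQuadrable (N : Star U (σ → ℕ)) (A : Star U (Set (σ → ℝ))) : Prop :=
  IsRare N (boundary N A)

/-- `f` is fast oscillating on `I`. -/
def FastOscillating (N : Star U (σ → ℕ)) (f : Star U ((σ → ℝ) → ℝ)) : Prop :=
  SIntegrable N f ∧
    ∀ A : Star U (Set (σ → ℝ)), IsQuadrable N A → IsInfinitesimal (integral N A f)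

/-- The integer `N i` that defines the one-dimensional grid `I_i`. -/
def axis (N : Star U (σ → ℕ)) (i : σ) : Star U (Fin 1 → ℕ) := Germ.map (fun n _ => n i) N

/-- The internal function `t ↦ f (ξ with its i-th coordinate replaced by t)` of one variable. -/
def slice (f : Star U ((σ → ℝ) → ℝ)) (ξ : Star U (σ → ℝ)) (i : σ) :
    Star U ((Fin 1 → ℝ) → ℝ) :=
  Germ.map₂ (fun g x t => g (Function.update x i (t 0))) f ξ

/-- `f` is a noise of mean `m` on `I`: `m` is Lebesgue integrable, `f` is S-integrable, and all the
functions of one variable on `I_i` that come from `f - m` by fixing the coordinates other than the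
`i`-th are fast oscillating. -/
def IsNoise (N : Star U (σ → ℕ)) (f m : Star U ((σ → ℝ) → ℝ)) : Prop :=
  LebesgueIntegrable N m ∧ SIntegrable N f ∧
    ∀ i, ∀ ξ ∈ grid N, FastOscillating (axis N i) (slice (f - m) ξ i)

/-- `f` is a zero-mean noise: one can take `0` as a mean. -/
def IsZeroMean (N : Star U (σ → ℕ)) (f : Star U ((σ → ℝ) → ℝ)) : Prop := IsNoise N f 0

/-- `f` is of class `S⁰` on `I`: S-continuous with limited values. -/
def IsClassS0 (N : Star U (σ → ℕ)) (f : Star U ((σ → ℝ) → ℝ)) : Prop :=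
  (∀ x ∈ grid N, IsLimited (app f x)) ∧ SContinuousOn f (grid N)

/-- `f` is of class `S¹` on `I`: it has limited values, and there are functions `g i` of class `S⁰`
(the partial derivatives) such that, for `x ≃ y` in `I`,
`f y - f x = ∑ i, g i x * (y i - x i) + η * ∑ i, |y i - x i|` with `η` infinitesimal. With one
variable this says that `(f y - f x) / (y - x) ≃ g x` whenever `x ≃ y` and `x ≠ y`. -/
def IsClassS1 (N : Star U (σ → ℕ)) (f : Star U ((σ → ℝ) → ℝ)) : Prop :=
  (∀ x ∈ grid N, IsLimited (app f x)) ∧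
    ∃ g : σ → Star U ((σ → ℝ) → ℝ), (∀ i, IsClassS0 N (g i)) ∧
      ∀ x ∈ grid N, ∀ y ∈ grid N, Near x y → ∃ η : Star U ℝ, IsInfinitesimal η ∧
        app f y - app f x =
          ∑ i, app (g i) x * (coord y i - coord x i) + η * ∑ i, |coord y i - coord x i|

end NonstandardNoise

end

open Filter

noncomputable section

namespace NonstandardNoise

/-! A class `S¹` function `φ` is S-continuous with limited values, and this carries over to its
slices. Its values on the grid have a common standard bound, so multiplication by `φ` preserves
S-integrability. An S-integrable `m` is limited off a rare set (Markov), and there `φ * m` is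
S-continuous wherever `m` is.

The core is `FastOscillating.classS0_mul`, on a single axis. S-continuity of a slice `ψ` gives, for
each standard tolerance, a standard mesh on whose cells `ψ` is nearly constant
(`SContinuousOn.exists_modulus`, by overspill). A quadrable set cut by a cell stays quadrable, so
the fast oscillating factor `h` has infinitesimal integral there. The number of cells is standard,
so replacing `ψ` by a constant on each cell leaves only an error of at most the tolerance times `∫
|h|` (`abs_stdIntegral_mul_le`). -/

variable {J : Type*} {U : Ultrafilter J} {σ : Type*} [Fintype σ] [DecidableEq σ]

/-! ### Arithmetic of limited and infinitesimal hyperreals. -/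

section Hyperreals

theorem isInfinitesimal_coe {a : J → ℝ} :
    IsInfinitesimal (a : Star U ℝ) ↔ ∀ r : ℝ, 0 < r → ∀ᶠ j in (U : Filter J), |a j| < r := by
  refine forall₂_congr fun r _ => ?_
  rw [Germ.abs_def]
  exact Germ.coe_lt

theorem isLimited_coe {a : J → ℝ} :
    IsLimited (a : Star U ℝ) ↔ ∃ r : ℝ, ∀ᶠ j in (U : Filter J), |a j| ≤ r := by
  refine exists_congr fun r => ?_
  rw [Germ.abs_def]
  exact Germ.coe_le

theorem IsInfinitesimal.add {a b : Star U ℝ} (ha : IsInfinitesimal a) (hb : IsInfinitesimal b) :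
    IsInfinitesimal (a + b) := by
  induction a using Germ.inductionOn with | _ a
  induction b using Germ.inductionOn with | _ b
  rw [← Germ.coe_add, isInfinitesimal_coe]
  rw [isInfinitesimal_coe] at ha hb
  intro r hr
  filter_upwards [ha (r / 2) (by positivity), hb (r / 2) (by positivity)] with j h₁ h₂
  calc |a j + b j| ≤ |a j| + |b j| := abs_add_le _ _
    _ < r := by linarith

theorem IsInfinitesimal.abs {a : Star U ℝ} (ha : IsInfinitesimal a) : IsInfinitesimal |a| := by
  intro r hr
  rw [abs_abs]
  exact ha r hr

theorem IsInfinitesimal.neg {a : Star U ℝ} (ha : IsInfinitesimal a) : IsInfinitesimal (-a) := by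
  intro r hr
  rw [abs_neg]
  exact ha r hr

theorem isInfinitesimal_zero : IsInfinitesimal (0 : Star U ℝ) := by
  intro r hr
  rw [abs_zero]
  exact Germ.const_lt hr

theorem IsInfinitesimal.sum {ι : Type*} {s : Finset ι} {a : ι → Star U ℝ}
    (ha : ∀ i ∈ s, IsInfinitesimal (a i)) : IsInfinitesimal (∑ i ∈ s, a i) :=
  Finset.sum_induction a IsInfinitesimal (fun _ _ => IsInfinitesimal.add) isInfinitesimal_zero ha

theorem IsLimited.mul_isInfinitesimal {a b : Star U ℝ} (ha : IsLimited a)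
    (hb : IsInfinitesimal b) : IsInfinitesimal (a * b) := by
  induction a using Germ.inductionOn with | _ a
  induction b using Germ.inductionOn with | _ b
  rw [← Germ.coe_mul, isInfinitesimal_coe]
  rw [isLimited_coe] at ha
  rw [isInfinitesimal_coe] at hb
  obtain ⟨c, hc⟩ := ha
  intro r hr
  filter_upwards [hc, hb (r / (|c| + 1)) (by positivity)] with j h₁ h₂
  have h₃ : |a j| ≤ |c| + 1 := by linarith [le_abs_self c]
  rw [Pi.mul_apply, abs_mul]
  calc |a j| * |b j| ≤ (|c| + 1) * |b j| := by gcongr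
    _ < (|c| + 1) * (r / (|c| + 1)) := by gcongr
    _ = r := by field_simp

theorem IsInfinitesimal.isLimited {a : Star U ℝ} (ha : IsInfinitesimal a) : IsLimited a :=
  ⟨1, (ha 1 one_pos).le⟩

theorem IsInfinitesimal.of_abs_le {a b : Star U ℝ} (hb : IsInfinitesimal b) (h : |a| ≤ |b|) :
    IsInfinitesimal a :=
  fun r hr => h.trans_lt (hb r hr)

theorem Near.symm {τ : Type*} {x y : Star U (τ → ℝ)} (h : Near x y) : Near y x := by
  intro i
  rw [← neg_sub]
  exact (h i).neg

end Hyperreals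

/-! ### Standard bounds for limited internal functions. -/

section Transfer

theorem zero_mem_stdGrid (n : σ → ℕ) : (0 : σ → ℝ) ∈ stdGrid n := by
  simp only [stdGrid, Fintype.mem_piFinset, Finset.mem_image, Finset.mem_range]
  exact fun i => ⟨0, by omega, by simp⟩

/-- An internal function with limited values on the grid has a standard bound there. -/
theorem eventually_abs_le_of_isLimited {n : J → σ → ℕ} {F : J → (σ → ℝ) → ℝ}
    (h : ∀ x ∈ grid (n : Star U (σ → ℕ)), IsLimited (app (F : Star U ((σ → ℝ) → ℝ)) x)) :
    ∃ r : ℝ, ∀ᶠ j in (U : Filter J), ∀ x ∈ stdGrid (n j), |F j x| ≤ r := by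
  -- The maximum points of `|F j|` form one point of the hyperfinite grid; the limited value there
  -- bounds all others.
  choose x hx hmax using fun j =>
    Finset.exists_max_image (stdGrid (n j)) (fun x => |F j x|) ⟨0, zero_mem_stdGrid _⟩
  obtain ⟨r, hr⟩ := isLimited_coe.1 (h (x : Star U (σ → ℝ)) (Eventually.of_forall hx))
  exact ⟨r, hr.mono fun j hj y hy => (hmax j y hy).trans hj⟩

end Transfer

/-! ### Finite sums over a standard grid. -/

section StdIntegral

variable {n : σ → ℕ} {A B : Set (σ → ℝ)} {F G : (σ → ℝ) → ℝ}

theorem stdIntegral_mono (hAB : A ⊆ B) (hG : ∀ x ∈ stdGrid n, x ∈ B → 0 ≤ G x)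
    (hFG : ∀ x ∈ stdGrid n, x ∈ A → F x ≤ G x) : stdIntegral n A F ≤ stdIntegral n B G := by
  classical
  unfold stdIntegral
  refine (Finset.sum_le_sum fun x hx => ?_).trans
    (Finset.sum_le_sum_of_subset_of_nonneg (t := {x ∈ stdGrid n | x ∈ B ∧ ∀ i, x i ≠ 1})
      (f := fun x => G x * ∏ i, (1 / (n i : ℝ))) ?_ ?_)
  · rw [Finset.mem_filter] at hx
    exact mul_le_mul_of_nonneg_right (hFG x hx.1 hx.2.1) (Finset.prod_nonneg fun i _ => by positivity)
  · intro x hx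
    rw [Finset.mem_filter] at hx ⊢
    exact ⟨hx.1, hAB hx.2.1, hx.2.2⟩
  · intro x hx _
    rw [Finset.mem_filter] at hx
    exact mul_nonneg (hG x hx.1 hx.2.1) (Finset.prod_nonneg fun i _ => by positivity)

theorem stdIntegral_const_mul (c : ℝ) :
    stdIntegral n A (fun x => c * F x) = c * stdIntegral n A F := by
  classical
  unfold stdIntegral
  rw [Finset.mul_sum]
  exact Finset.sum_congr rfl fun x _ => mul_assoc _ _ _

theorem stdIntegral_add :
    stdIntegral n A (fun x => F x + G x) = stdIntegral n A F + stdIntegral n A G := by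
  classical
  unfold stdIntegral
  rw [← Finset.sum_add_distrib]
  exact Finset.sum_congr rfl fun x _ => add_mul _ _ _

theorem stdIntegral_nonneg (hF : ∀ x, 0 ≤ F x) : 0 ≤ stdIntegral n A F := by
  classical
  exact Finset.sum_nonneg fun x _ => mul_nonneg (hF x) (Finset.prod_nonneg fun i _ => by positivity)

theorem abs_stdIntegral_le : |stdIntegral n A F| ≤ stdIntegral n A fun x => |F x| := by
  classical
  unfold stdIntegral
  refine (Finset.abs_sum_le_sum_abs _ _).trans_eq (Finset.sum_congr rfl fun x _ => ?_)
  rw [abs_mul, abs_of_nonneg (a := ∏ i, (1 / (n i : ℝ)))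
    (Finset.prod_nonneg fun i _ => by positivity)]

theorem stdIntegral_union_le (hF : ∀ x, 0 ≤ F x) :
    stdIntegral n (A ∪ B) F ≤ stdIntegral n A F + stdIntegral n B F := by
  classical
  unfold stdIntegral
  have hw : ∀ x, 0 ≤ F x * ∏ i, (1 / (n i : ℝ)) := fun x =>
    mul_nonneg (hF x) (Finset.prod_nonneg fun i _ => by positivity)
  rw [← Finset.sum_union_inter]
  refine le_add_of_le_of_nonneg
    (Finset.sum_le_sum_of_subset_of_nonneg ?_ fun x _ _ => hw x) (Finset.sum_nonneg fun x _ => hw x)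
  intro x
  simp only [Finset.mem_filter, Finset.mem_union, Set.mem_union]
  tauto

/-- The integral splits along the fibres of a map to a finite set. -/
theorem stdIntegral_eq_sum_fiber {ι : Type*} [DecidableEq ι] {s : Finset ι} {g : (σ → ℝ) → ι}
    (hg : ∀ x ∈ stdGrid n, g x ∈ s) :
    stdIntegral n A F = ∑ l ∈ s, stdIntegral n (A ∩ {x | g x = l}) F := by
  classical
  unfold stdIntegral
  rw [← Finset.sum_fiberwise_of_maps_to (g := g) (t := s)
    fun x hx => hg x (Finset.mem_filter.1 hx).1]
  refine Finset.sum_congr rfl fun l _ => Finset.sum_congr ?_ fun _ _ => rfl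
  ext x
  simp only [Finset.mem_filter, Set.mem_inter_iff, Set.mem_ofPred_eq]
  tauto

/-- If `F` oscillates by at most `ε` on each fibre of `g`, then the integral of `F * G` is
controlled by the integrals of `G` over the fibres. -/
theorem abs_stdIntegral_mul_le {ι : Type*} [DecidableEq ι] {s : Finset ι} {g : (σ → ℝ) → ι}
    (hg : ∀ x ∈ stdGrid n, g x ∈ s) {r ε : ℝ} (hr : ∀ x ∈ stdGrid n, |F x| ≤ r) (hε : 0 ≤ ε)
    (hF : ∀ x ∈ stdGrid n, ∀ y ∈ stdGrid n, g x = g y → |F x - F y| ≤ ε) :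
    |stdIntegral n A fun x => F x * G x| ≤
      r * ∑ l ∈ s, |stdIntegral n (A ∩ {x | g x = l}) G| +
        ε * stdIntegral n Set.univ fun x => |G x| := by
  have hr₀ : 0 ≤ r := (abs_nonneg _).trans (hr 0 (zero_mem_stdGrid n))
  have key : ∀ l ∈ s, |stdIntegral n (A ∩ {x | g x = l}) fun x => F x * G x| ≤
      r * |stdIntegral n (A ∩ {x | g x = l}) G| +
        ε * stdIntegral n (Set.univ ∩ {x | g x = l}) fun x => |G x| := by
    intro l _
    -- `c` is a value of `F` on the fibre, or `0` if the fibre misses the grid.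
    obtain ⟨c, hc, hcF⟩ : ∃ c : ℝ, |c| ≤ r ∧ ∀ x ∈ stdGrid n, g x = l → |F x - c| ≤ ε := by
      by_cases h : ∃ y ∈ stdGrid n, g y = l
      · obtain ⟨y, hy, rfl⟩ := h
        exact ⟨F y, hr y hy, fun x hx hxy => hF x hx y hy hxy⟩
      · exact ⟨0, by simpa using hr₀, fun x hx hxl => absurd ⟨x, hx, hxl⟩ h⟩
    -- The constant part keeps the cancellation in `G`; the remainder is estimated through `|G|`.
    have hsplit : (stdIntegral n (A ∩ {x | g x = l}) fun x => F x * G x) =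
        c * stdIntegral n (A ∩ {x | g x = l}) G +
          stdIntegral n (A ∩ {x | g x = l}) fun x => (F x - c) * G x := by
      rw [← stdIntegral_const_mul, ← stdIntegral_add]
      congr 1
      funext x
      ring
    rw [hsplit]
    refine (abs_add_le _ _).trans (add_le_add ?_ ?_)
    · rw [abs_mul]
      gcongr
    · refine abs_stdIntegral_le.trans ?_
      rw [← stdIntegral_const_mul]
      refine stdIntegral_mono (Set.inter_subset_inter_left _ (Set.subset_univ _))
        (fun x _ _ => by positivity) fun x hx hxA => ?_
      rw [abs_mul]
      exact mul_le_mul_of_nonneg_right (hcF x hx hxA.2) (abs_nonneg _)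
  rw [stdIntegral_eq_sum_fiber hg,
    stdIntegral_eq_sum_fiber (A := Set.univ) (F := fun x => |G x|) hg, Finset.mul_sum,
    Finset.mul_sum, ← Finset.sum_add_distrib]
  exact (Finset.abs_sum_le_sum_abs _ _).trans (Finset.sum_le_sum key)

end StdIntegral

/-! ### Rare sets. -/

section Rare

variable {N : Star U (σ → ℕ)}

theorem IsRare.mono {R S : Set (Star U (σ → ℝ))} (hS : IsRare N S) (h : R ⊆ S) : IsRare N R := by
  intro ε hε
  obtain ⟨A, hA, hAε⟩ := hS ε hε
  exact ⟨A, fun x hx => hA x (h hx), hAε⟩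

theorem IsRare.union {R S : Set (Star U (σ → ℝ))} (hR : IsRare N R) (hS : IsRare N S) :
    IsRare N (R ∪ S) := by
  intro ε hε
  obtain ⟨A, hA, hAε⟩ := hR (ε / 2) (by positivity)
  obtain ⟨B, hB, hBε⟩ := hS (ε / 2) (by positivity)
  induction A using Germ.inductionOn with | _ A
  induction B using Germ.inductionOn with | _ B
  induction N using Germ.inductionOn with | _ n
  refine ⟨((fun j => A j ∪ B j : J → Set (σ → ℝ)) : Star U (Set (σ → ℝ))), ?_, ?_⟩
  · intro x hx
    induction x using Germ.inductionOn with | _ x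
    rcases hx with hx | hx
    · have h : ∀ᶠ j in (U : Filter J), x j ∈ A j := hA _ hx
      exact h.mono fun j hj => Or.inl hj
    · have h : ∀ᶠ j in (U : Filter J), x j ∈ B j := hB _ hx
      exact h.mono fun j hj => Or.inr hj
  · have h₁ : ∀ᶠ j in (U : Filter J), stdIntegral (n j) (A j) (fun _ => 1) ≤ ε / 2 :=
      Germ.coe_le.1 hAε
    have h₂ : ∀ᶠ j in (U : Filter J), stdIntegral (n j) (B j) (fun _ => 1) ≤ ε / 2 :=
      Germ.coe_le.1 hBε
    refine Germ.coe_le.2 ?_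
    filter_upwards [h₁, h₂] with j h₁ h₂
    exact (stdIntegral_union_le fun _ => zero_le_one).trans (by linarith)

/-- An S-integrable function has limited values outside a rare set. -/
theorem SIntegrable.isRare_not_isLimited {f : Star U ((σ → ℝ) → ℝ)} (hf : SIntegrable N f) :
    IsRare N {x | x ∈ grid N ∧ ¬ IsLimited (app f x)} := by
  intro ε hε
  obtain ⟨hf, -⟩ := hf
  induction f using Germ.inductionOn with | _ F
  induction N using Germ.inductionOn with | _ n
  obtain ⟨r, hr⟩ := isLimited_coe.1 hf
  -- Markov's inequality at this threshold gives measure at most `ε`; the `+ 1` keeps the threshold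
  -- positive.
  have hK : 0 < (|r| + 1) / ε := by positivity
  refine ⟨((fun j => {x | (|r| + 1) / ε < |F j x|} : J → Set (σ → ℝ)) : Star U (Set (σ → ℝ))),
    ?_, ?_⟩
  · rintro x ⟨-, hx⟩
    induction x using Germ.inductionOn with | _ x
    have hx' : ¬ ∀ᶠ j in (U : Filter J), |F j (x j)| ≤ (|r| + 1) / ε :=
      fun h => hx (isLimited_coe.2 ⟨_, h⟩)
    rw [← Ultrafilter.eventually_not] at hx'
    exact hx'.mono fun j hj => not_le.1 hj
  · refine Germ.coe_le.2 ?_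
    filter_upwards [hr] with j hj
    have h : (|r| + 1) / ε * stdIntegral (n j) {x | (|r| + 1) / ε < |F j x|} (fun _ => 1) ≤
        stdIntegral (n j) Set.univ fun x => |F j x| := by
      rw [← stdIntegral_const_mul]
      refine stdIntegral_mono (Set.subset_univ _) (fun x _ _ => abs_nonneg _) fun x _ hx => ?_
      rw [mul_one]
      exact le_of_lt hx
    have h' : (|r| + 1) / ε * stdIntegral (n j) {x | (|r| + 1) / ε < |F j x|} (fun _ => 1) ≤
        (|r| + 1) / ε * ε := by
      rw [div_mul_cancel₀ _ hε.ne']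
      exact (h.trans ((le_abs_self _).trans hj)).trans (by linarith [le_abs_self r])
    exact le_of_mul_le_mul_left h' hK

end Rare

/-! ### Products with functions of class `S⁰`. -/

section Products

variable {N : Star U (σ → ℕ)} {φ f : Star U ((σ → ℝ) → ℝ)}

theorem app_mul {X : Type*} (f g : Star U (X → ℝ)) (x : Star U X) :
    app (f * g) x = app f x * app g x := by
  induction f using Germ.inductionOn with | _ F
  induction g using Germ.inductionOn with | _ G
  induction x using Germ.inductionOn with | _ x
  rfl

/-- A class `S¹` function is of class `S⁰`. -/
theorem IsClassS1.isClassS0 (hφ : IsClassS1 N φ) : IsClassS0 N φ := by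
  obtain ⟨hlim, g, hg, h⟩ := hφ
  refine ⟨hlim, fun x hx y hy hxy => ?_⟩
  obtain ⟨η, hη, he⟩ := h y hy x hx hxy.symm
  rw [he]
  refine IsInfinitesimal.add (IsInfinitesimal.sum fun i _ =>
    ((hg i).1 y hy).mul_isInfinitesimal (hxy i)) ?_
  exact hη.isLimited.mul_isInfinitesimal (IsInfinitesimal.sum fun i _ => (hxy i).abs)

/-- The product of an S-integrable function by a function with limited values is S-integrable. -/
theorem SIntegrable.limited_mul (hf : SIntegrable N f)
    (hφ : ∀ x ∈ grid N, IsLimited (app φ x)) : SIntegrable N (φ * f) := by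
  obtain ⟨hf₁, hf₂⟩ := hf
  induction f using Germ.inductionOn with | _ F
  induction φ using Germ.inductionOn with | _ P
  induction N using Germ.inductionOn with | _ n
  obtain ⟨r, hr⟩ := eventually_abs_le_of_isLimited hφ
  have key : ∀ A : J → Set (σ → ℝ), ∀ᶠ j in (U : Filter J),
      |stdIntegral (n j) (A j) (fun x => |P j x * F j x|)| ≤
        |r * stdIntegral (n j) (A j) (fun x => |F j x|)| := by
    intro A
    filter_upwards [hr] with j hj
    have hr₀ : 0 ≤ r := (abs_nonneg _).trans (hj 0 (zero_mem_stdGrid _))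
    rw [abs_of_nonneg (stdIntegral_nonneg fun x => abs_nonneg _), ← stdIntegral_const_mul]
    refine le_trans (stdIntegral_mono subset_rfl (fun x _ _ => by positivity) fun x hx _ => ?_)
      (le_abs_self _)
    rw [abs_mul]
    exact mul_le_mul_of_nonneg_right (hj x hx) (abs_nonneg _)
  refine ⟨isLimited_coe.2 ?_, fun A hA => ?_⟩
  · obtain ⟨c, hc⟩ := isLimited_coe.1 hf₁
    refine ⟨|r| * c, ?_⟩
    filter_upwards [key fun _ => Set.univ, hc] with j h₁ h₂
    refine le_trans h₁ ?_
    rw [abs_mul]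
    exact mul_le_mul_of_nonneg_left h₂ (abs_nonneg r)
  · have h := hf₂ A hA
    induction A using Germ.inductionOn with | _ A
    have hr' : IsLimited (std r : Star U ℝ) := ⟨|r|, le_of_eq (Germ.abs_def _)⟩
    refine (hr'.mul_isInfinitesimal h).of_abs_le ?_
    rw [Germ.abs_def, Germ.abs_def]
    exact Germ.coe_le.2 (key A)

theorem IsInfinitesimal.mul_sub_mul {a b c d : Star U ℝ} (hac : IsInfinitesimal (a - c))
    (hbd : IsInfinitesimal (b - d)) (ha : IsLimited a) (hd : IsLimited d) :
    IsInfinitesimal (a * b - c * d) := by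
  have h : a * b - c * d = a * (b - d) + d * (a - c) := by ring
  rw [h]
  exact (ha.mul_isInfinitesimal hbd).add (hd.mul_isInfinitesimal hac)

/-- The exceptional set of `f` is enlarged by the points where `f` is unlimited, since there `φ x ≃
φ y` would not control `(φ x - φ y) * f y`. -/
theorem LebesgueIntegrable.classS0_mul (hf : LebesgueIntegrable N f) (hφ : IsClassS0 N φ) :
    LebesgueIntegrable N (φ * f) := by
  obtain ⟨hint, R, hRN, hR, hcont⟩ := hf
  refine ⟨hint.limited_mul hφ.1, R ∪ {x | x ∈ grid N ∧ ¬ IsLimited (app f x)},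
    Set.union_subset hRN fun x hx => hx.1, hR.union hint.isRare_not_isLimited, ?_⟩
  rintro x ⟨hx, hxR⟩ y ⟨hy, hyR⟩ hxy
  rw [Set.mem_union, not_or] at hxR hyR
  rw [app_mul, app_mul]
  refine (hφ.2 x hx y hy hxy).mul_sub_mul (hcont x ⟨hx, hxR.1⟩ y ⟨hy, hyR.1⟩ hxy) (hφ.1 x hx) ?_
  by_contra h
  exact hyR.2 ⟨hy, h⟩

end Products

/-! ### Uniform modulus of S-continuity. -/

section Overspill

/-- S-continuity on the grid is uniform: for every standard `ε > 0` some standard modulus works. -/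
theorem SContinuousOn.exists_modulus {n : J → σ → ℕ} {F : J → (σ → ℝ) → ℝ} {M : J → ℕ}
    (hM : IsUnlimitedNat (M : Star U ℕ))
    (hF : SContinuousOn (F : Star U ((σ → ℝ) → ℝ)) (grid (n : Star U (σ → ℕ))))
    {ε : ℝ} (hε : 0 < ε) :
    ∃ k : ℕ, ∀ᶠ j in (U : Filter J), ∀ x ∈ stdGrid (n j), ∀ y ∈ stdGrid (n j),
      (∀ i, |x i - y i| * (k + 1) ≤ 1) → |F j x - F j y| < ε := by
  classical
  by_contra hc
  push Not at hc
  let Q : ℕ → J → Prop := fun k j => ∃ x ∈ stdGrid (n j), ∃ y ∈ stdGrid (n j),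
    (∀ i, |x i - y i| * (k + 1) ≤ 1) ∧ ε ≤ |F j x - F j y|
  have hQ : ∀ k, ∀ᶠ j in (U : Filter J), Q k j := hc
  -- Overspill: each standard `k` fails as a modulus, so the largest failing `k` up to the unlimited
  -- `M` is itself unlimited. Its witnesses are infinitely close points with values `ε` apart.
  let κ : J → ℕ := fun j => Nat.findGreatest (fun k => Q k j) (M j)
  have hκ : ∀ᶠ j in (U : Filter J), Q (κ j) j :=
    (hQ 0).mono fun j hj => Nat.findGreatest_spec (P := fun k => Q k j) (Nat.zero_le _) hj
  have hκ' : ∀ k : ℕ, ∀ᶠ j in (U : Filter J), k ≤ κ j := by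
    intro k
    have hk : ∀ᶠ j in (U : Filter J), k < M j := Germ.coe_lt.1 (hM k)
    filter_upwards [hk, hQ k] with j h₁ h₂
    exact Nat.le_findGreatest h₁.le h₂
  have hxy : ∀ j, ∃ x y, Q (κ j) j → x ∈ stdGrid (n j) ∧ y ∈ stdGrid (n j) ∧
      (∀ i, |x i - y i| * (κ j + 1) ≤ 1) ∧ ε ≤ |F j x - F j y| := by
    intro j
    by_cases hj : Q (κ j) j
    · obtain ⟨x, hx, y, hy, h⟩ := hj
      exact ⟨x, y, fun _ => ⟨hx, hy, h⟩⟩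
    · exact ⟨0, 0, fun h => absurd h hj⟩
  choose x y hxy using hxy
  have hnear : Near (x : Star U (σ → ℝ)) (y : Star U (σ → ℝ)) := by
    intro i
    refine isInfinitesimal_coe.2 fun r hr => ?_
    obtain ⟨k, hk⟩ := exists_nat_gt (1 / r)
    filter_upwards [hκ, hκ' k] with j h₁ h₂
    have h₃ := (hxy j h₁).2.2.1 i
    have h₄ : (k : ℝ) ≤ κ j := by exact_mod_cast h₂
    rw [div_lt_iff₀ hr] at hk
    change |x j i - y j i| < r
    by_contra h
    push Not at h
    nlinarith [mul_le_mul h (by linarith : (k : ℝ) ≤ κ j + 1) (Nat.cast_nonneg k) (abs_nonneg _)]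
  have h := isInfinitesimal_coe.1 (hF (x : Star U (σ → ℝ)) (hκ.mono fun j hj => (hxy j hj).1)
    (y : Star U (σ → ℝ)) (hκ.mono fun j hj => (hxy j hj).2.1) hnear) ε hε
  obtain ⟨j, h₁, h₂⟩ := (h.and hκ).exists
  exact absurd h₁ (not_lt.2 (hxy j h₂).2.2.2)

end Overspill

/-! ### Boolean operations on quadrable sets. -/

section Quadrable

variable {N : Star U (σ → ℕ)}

theorem imem_coe {X : Type*} {x : J → X} {A : J → Set X} :
    IMem (x : Star U X) (A : Star U (Set X)) ↔ ∀ᶠ j in (U : Filter J), x j ∈ A j :=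
  Iff.rfl

/-- The definition of the boundary is symmetric in a set and its complement. -/
theorem IsQuadrable.compl {A : J → Set (σ → ℝ)} (hA : IsQuadrable N (A : Star U (Set (σ → ℝ)))) :
    IsQuadrable N ((fun j => (A j)ᶜ : J → Set (σ → ℝ)) : Star U (Set (σ → ℝ))) := by
  have hmem : ∀ x : Star U (σ → ℝ),
      IMem x ((fun j => (A j)ᶜ : J → Set (σ → ℝ)) : Star U (Set (σ → ℝ))) ↔
        ¬ IMem x (A : Star U (Set (σ → ℝ))) := by
    intro x
    induction x using Germ.inductionOn with | _ x
    exact Ultrafilter.eventually_not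
  refine IsRare.mono hA ?_
  rintro x ⟨hx, ⟨y, hy, hyA, hxy⟩, z, hz, hzA, hxz⟩
  rw [hmem] at hyA hzA
  exact ⟨hx, ⟨z, hz, not_not.1 hzA, hxz⟩, y, hy, hyA, hxy⟩

/-- A point outside the intersection misses one of the two sets, so the boundary lies in the union
of the two boundaries. -/
theorem IsQuadrable.inter {A B : J → Set (σ → ℝ)}
    (hA : IsQuadrable N (A : Star U (Set (σ → ℝ)))) (hB : IsQuadrable N (B : Star U (Set (σ → ℝ)))) :
    IsQuadrable N ((fun j => A j ∩ B j : J → Set (σ → ℝ)) : Star U (Set (σ → ℝ))) := by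
  have hmem : ∀ x : Star U (σ → ℝ),
      IMem x ((fun j => A j ∩ B j : J → Set (σ → ℝ)) : Star U (Set (σ → ℝ))) ↔
        IMem x (A : Star U (Set (σ → ℝ))) ∧ IMem x (B : Star U (Set (σ → ℝ))) := by
    intro x
    induction x using Germ.inductionOn with | _ x
    exact eventually_and
  refine (IsRare.union hA hB).mono ?_
  rintro x ⟨hx, ⟨y, hy, hyA, hxy⟩, z, hz, hzA, hxz⟩
  rw [hmem] at hyA hzA
  by_cases h : IMem z (A : Star U (Set (σ → ℝ)))
  · exact Or.inr ⟨hx, ⟨y, hy, hyA.2, hxy⟩, z, hz, fun h' => hzA ⟨h, h'⟩, hxz⟩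
  · exact Or.inl ⟨hx, ⟨y, hy, hyA.1, hxy⟩, z, hz, h, hxz⟩

end Quadrable

/-! ### Fast oscillation on one axis. -/

section Line

/-- At most `2 * δ * n 0 + 1` multiples of `1 / n 0` lie in an interval of length `2 * δ`, each of
mass at most `1 / n 0`. -/
theorem stdIntegral_interval_le {n : Fin 1 → ℕ} (hn : 0 < n 0) {a δ : ℝ} (hδ : 0 < δ) :
    stdIntegral n {t | |t 0 - a| < δ} (fun _ => 1) ≤ 2 * δ + 1 / n 0 := by
  classical
  have hn' : (0 : ℝ) < n 0 := by exact_mod_cast hn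
  let s : Finset ℤ := Finset.Icc ⌈(n 0 : ℝ) * (a - δ)⌉ ⌊(n 0 : ℝ) * (a + δ)⌋
  have hsub : {x ∈ stdGrid n | x ∈ {t : Fin 1 → ℝ | |t 0 - a| < δ} ∧ ∀ i, x i ≠ 1} ⊆
      s.image fun k : ℤ => fun _ : Fin 1 => (k : ℝ) / n 0 := by
    intro x hx
    rw [Finset.mem_filter] at hx
    obtain ⟨hx, hxa, -⟩ := hx
    obtain ⟨k, -, hk⟩ := Finset.mem_image.1 (Fintype.mem_piFinset.1 hx 0)
    have hxa' : |x 0 - a| < δ := hxa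
    rw [abs_lt, ← hk] at hxa'
    have hkn : (n 0 : ℝ) * (k / n 0) = k := by field_simp
    refine Finset.mem_image.2 ⟨k, Finset.mem_Icc.2 ⟨Int.ceil_le.2 ?_, Int.le_floor.2 ?_⟩, ?_⟩
    · rw [Int.cast_natCast, ← hkn]
      exact mul_le_mul_of_nonneg_left (by linarith) hn'.le
    · rw [Int.cast_natCast, ← hkn]
      exact mul_le_mul_of_nonneg_left (by linarith) hn'.le
    · funext i
      rw [Subsingleton.elim i 0, ← hk, Int.cast_natCast]
  have hcard : (s.card : ℝ) ≤ 2 * δ * n 0 + 1 := by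
    rw [Int.card_Icc, ← Int.cast_natCast, Int.toNat_eq_max, Int.cast_max]
    refine max_le ?_ (by simp; positivity)
    push_cast
    linarith [Int.floor_le ((n 0 : ℝ) * (a + δ)), Int.le_ceil ((n 0 : ℝ) * (a - δ))]
  have h := (Finset.card_le_card hsub).trans Finset.card_image_le
  have h' : (({x ∈ stdGrid n | x ∈ {t : Fin 1 → ℝ | |t 0 - a| < δ} ∧ ∀ i, x i ≠ 1}).card : ℝ) ≤
      2 * δ * n 0 + 1 := le_trans (by exact_mod_cast h) hcard
  unfold stdIntegral
  rw [Finset.sum_const, nsmul_eq_mul, one_mul, Fin.prod_univ_one]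
  calc _ ≤ (2 * δ * n 0 + 1) * (1 / (n 0 : ℝ)) := by
        exact mul_le_mul_of_nonneg_right (le_trans (le_of_eq (by congr!)) h') (by positivity)
    _ = 2 * δ + 1 / n 0 := by field_simp

/-- Boundary points are infinitely close to `a`, hence within `ε / 4` of it, and the interval has
measure at most `ε / 2 + 1 / n 0`. -/
theorem isQuadrable_halfLine {n : J → Fin 1 → ℕ}
    (hn : IsUnlimitedNat ((fun j => n j 0 : J → ℕ) : Star U ℕ)) (a : ℝ) :
    IsQuadrable (n : Star U (Fin 1 → ℕ))
      ((fun _ => {t | t 0 < a} : J → Set (Fin 1 → ℝ)) : Star U (Set (Fin 1 → ℝ))) := by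
  intro ε hε
  refine ⟨((fun _ => {t | |t 0 - a| < ε / 4} : J → Set (Fin 1 → ℝ)) : Star U (Set (Fin 1 → ℝ))),
    ?_, ?_⟩
  · rintro x ⟨-, ⟨y, -, hyA, hxy⟩, z, -, hzA, hxz⟩
    induction x using Germ.inductionOn with | _ x
    induction y using Germ.inductionOn with | _ y
    induction z using Germ.inductionOn with | _ z
    rw [imem_coe] at hyA hzA
    rw [← Ultrafilter.eventually_not] at hzA
    refine imem_coe.2 ?_
    filter_upwards [hyA, hzA, isInfinitesimal_coe.1 (hxy 0) (ε / 4) (by positivity),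
      isInfinitesimal_coe.1 (hxz 0) (ε / 4) (by positivity)] with j h₁ h₂ h₃ h₄
    have h₁ : y j 0 < a := h₁
    have h₂ : ¬ z j 0 < a := h₂
    have h₃ : |x j 0 - y j 0| < ε / 4 := h₃
    have h₄ : |x j 0 - z j 0| < ε / 4 := h₄
    change |x j 0 - a| < ε / 4
    rw [abs_lt] at *
    constructor <;> linarith
  · obtain ⟨k, hk⟩ := exists_nat_gt (2 / ε)
    have hnk : ∀ᶠ j in (U : Filter J), k < n j 0 := Germ.coe_lt.1 (hn k)
    refine Germ.coe_le.2 ?_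
    filter_upwards [hnk] with j hj
    refine (stdIntegral_interval_le (by omega) (by positivity)).trans ?_
    have hj' : (k : ℝ) < n j 0 := by exact_mod_cast hj
    have h₀ : (0 : ℝ) < n j 0 := lt_of_le_of_lt (Nat.cast_nonneg k) hj'
    have h₁ : 1 / (n j 0 : ℝ) ≤ ε / 2 := by
      rw [div_lt_iff₀ hε] at hk
      rw [div_le_iff₀ h₀]
      nlinarith
    linarith

theorem mem_stdGrid_bounds {n : σ → ℕ} {x : σ → ℝ} (hx : x ∈ stdGrid n) (i : σ) :
    0 ≤ x i ∧ x i ≤ 1 := by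
  obtain ⟨k, hk, hk'⟩ := Finset.mem_image.1 (Fintype.mem_piFinset.1 hx i)
  rw [← hk']
  have : (k : ℝ) ≤ n i := by exact_mod_cast Nat.lt_succ_iff.1 (Finset.mem_range.1 hk)
  exact ⟨by positivity, div_le_one_of_le₀ this (by positivity)⟩

/-- Writing a mesh cell through half-lines makes its quadrability follow from
`isQuadrable_halfLine`. -/
theorem floor_fiber_eq (k : ℕ) (l : ℤ) :
    {t : Fin 1 → ℝ | ⌊t 0 * (k + 1)⌋ = l} =
      {t : Fin 1 → ℝ | t 0 < (l : ℝ) / (k + 1)}ᶜ ∩ {t | t 0 < ((l : ℝ) + 1) / (k + 1)} := by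
  have hk : (0 : ℝ) < k + 1 := by positivity
  ext t
  simp only [Set.mem_inter_iff, Set.mem_compl_iff, Set.mem_ofPred_eq]
  rw [Int.floor_eq_iff, not_lt, div_le_iff₀ hk, lt_div_iff₀ hk]

/-- The product of a fast oscillating function of one variable by a function of class `S⁰` is fast
oscillating. -/
theorem FastOscillating.classS0_mul {N : Star U (Fin 1 → ℕ)} (hN : IsUnlimitedNat (coord N 0))
    {ψ h : Star U ((Fin 1 → ℝ) → ℝ)} (hh : FastOscillating N h) (hψ : IsClassS0 N ψ) :
    FastOscillating N (ψ * h) := by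
  refine ⟨hh.1.limited_mul hψ.1, fun A hA => ?_⟩
  obtain ⟨⟨hlim, -⟩, hosc⟩ := hh
  induction N using Germ.inductionOn with | _ n
  induction ψ using Germ.inductionOn with | _ P
  induction h using Germ.inductionOn with | _ H
  induction A using Germ.inductionOn with | _ A
  obtain ⟨c, hc⟩ := isLimited_coe.1 hlim
  obtain ⟨r, hr⟩ := eventually_abs_le_of_isLimited hψ.1
  refine isInfinitesimal_coe.2 fun ε hε => ?_
  -- As `c` bounds `∫ |h|`, this tolerance costs at most `ε / 2`; the sum over the cells takes the
  -- other half.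
  have hε' : 0 < ε / (2 * (|c| + 1)) := by positivity
  obtain ⟨k, hk⟩ := hψ.2.exists_modulus (M := fun j => n j 0) hN hε'
  have hosc' : ∀ l : ℤ, IsInfinitesimal ((fun j => stdIntegral (n j)
      (A j ∩ {t | ⌊t 0 * (k + 1)⌋ = l}) (H j) : J → ℝ) : Star U ℝ) := by
    intro l
    rw [floor_fiber_eq]
    exact hosc _
      (hA.inter ((isQuadrable_halfLine hN _).compl.inter (isQuadrable_halfLine hN _)))
  -- The index `k + 1` is attained only at the right end point `1`.
  let s : Finset ℤ := Finset.Icc 0 (k + 1)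
  have hsum : IsInfinitesimal ((fun j => r * ∑ l ∈ s, |stdIntegral (n j)
      (A j ∩ {t | ⌊t 0 * (k + 1)⌋ = l}) (H j)| : J → ℝ) : Star U ℝ) := by
    refine isInfinitesimal_coe.2 fun δ hδ => ?_
    have hev := (eventually_all_finset s).2 fun l _ => isInfinitesimal_coe.1 (hosc' l)
      (δ / ((|r| + 1) * (s.card + 1))) (by positivity)
    filter_upwards [hev] with j hj
    rw [abs_mul, Finset.abs_sum_of_nonneg fun _ _ => abs_nonneg _]
    have h₁ := Finset.sum_le_card_nsmul s _ _ fun l hl => (hj l hl).le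
    rw [nsmul_eq_mul] at h₁
    calc _ ≤ |r| * (s.card * (δ / ((|r| + 1) * (s.card + 1)))) :=
          mul_le_mul_of_nonneg_left h₁ (abs_nonneg r)
      _ = δ * (|r| * s.card / ((|r| + 1) * (s.card + 1))) := by ring
      _ < δ * 1 := by
          refine mul_lt_mul_of_pos_left ?_ hδ
          rw [div_lt_one (by positivity)]
          nlinarith [abs_nonneg r, (Nat.cast_nonneg s.card : (0 : ℝ) ≤ s.card)]
      _ = δ := mul_one δ
  filter_upwards [hc, hr, hk, isInfinitesimal_coe.1 hsum (ε / 2) (by positivity)]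
    with j hc hr hk hsum
  have hg : ∀ x ∈ stdGrid (n j), ⌊x 0 * ((k : ℝ) + 1)⌋ ∈ s := by
    intro x hx
    obtain ⟨h₀, h₁⟩ := mem_stdGrid_bounds hx 0
    refine Finset.mem_Icc.2 ⟨Int.floor_nonneg.2 (by positivity), Int.floor_le_iff.2 ?_⟩
    push_cast
    nlinarith [(Nat.cast_nonneg k : (0 : ℝ) ≤ k)]
  -- Points with equal floors differ by less than `1 / (k + 1)`, so the modulus `k` applies on each
  -- cell.
  have hosc_le := abs_stdIntegral_mul_le (A := A j) (F := P j) (G := H j) hg hr hε'.le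
    fun x hx y hy hxy => (hk x hx y hy fun i => by
      rw [Subsingleton.elim i 0, ← abs_of_pos (by positivity : (0 : ℝ) < k + 1), ← abs_mul, sub_mul]
      exact (Int.abs_sub_lt_one_of_floor_eq_floor hxy).le).le
  have hc : |stdIntegral (n j) Set.univ (fun x => |H j x|)| ≤ c := hc
  have hc' : ε / (2 * (|c| + 1)) * stdIntegral (n j) Set.univ (fun x => |H j x|) ≤
      ε / (2 * (|c| + 1)) * (|c| + 1) :=
    mul_le_mul_of_nonneg_left (by linarith [(le_abs_self _).trans hc, le_abs_self c]) hε'.le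
  have he : ε / (2 * (|c| + 1)) * (|c| + 1) = ε / 2 := by field_simp
  calc _ ≤ _ := hosc_le
    _ < ε := by linarith [(le_abs_self _).trans_lt hsum]

end Line

/-! ### Passage to slices, and noises. -/

section Slices

variable {N : Star U (σ → ℕ)}

/-- The slices of a class `S⁰` function are of class `S⁰`. -/
theorem IsClassS0.slice {φ : Star U ((σ → ℝ) → ℝ)} (hφ : IsClassS0 N φ) {ξ : Star U (σ → ℝ)}
    (hξ : ξ ∈ grid N) (i : σ) : IsClassS0 (axis N i) (slice φ ξ i) := by
  have happ : ∀ t, app (NonstandardNoise.slice φ ξ i) t =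
      app φ (Germ.map₂ (fun x t => Function.update x i (t 0)) ξ t) := by
    intro t
    induction φ using Germ.inductionOn with | _ P
    induction ξ using Germ.inductionOn with | _ ξ
    induction t using Germ.inductionOn with | _ t
    rfl
  have hgrid : ∀ t ∈ grid (axis N i),
      Germ.map₂ (fun x (t : Fin 1 → ℝ) => Function.update x i (t 0)) ξ t ∈ grid N := by
    intro t ht
    induction N using Germ.inductionOn with | _ n
    induction ξ using Germ.inductionOn with | _ ξ
    induction t using Germ.inductionOn with | _ t
    have hξ' : ∀ᶠ j in (U : Filter J), ξ j ∈ stdGrid (n j) := hξ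
    have ht' : ∀ᶠ j in (U : Filter J), t j ∈ stdGrid (fun _ : Fin 1 => n j i) := ht
    have h : ∀ᶠ j in (U : Filter J), Function.update (ξ j) i (t j 0) ∈ stdGrid (n j) := by
      filter_upwards [hξ', ht'] with j h₁ h₂
      refine Fintype.mem_piFinset.2 fun l => ?_
      by_cases hl : l = i
      · subst hl
        rw [Function.update_self]
        exact Fintype.mem_piFinset.1 h₂ 0
      · rw [Function.update_of_ne hl]
        exact Fintype.mem_piFinset.1 h₁ l
    exact h
  have hnear : ∀ s t : Star U (Fin 1 → ℝ), Near s t →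
      Near (Germ.map₂ (fun x t => Function.update x i (t 0)) ξ s)
        (Germ.map₂ (fun x t => Function.update x i (t 0)) ξ t) := by
    intro s t hst l
    induction ξ using Germ.inductionOn with | _ ξ
    induction s using Germ.inductionOn with | _ s
    induction t using Germ.inductionOn with | _ t
    refine isInfinitesimal_coe.2 fun r hr => ?_
    filter_upwards [isInfinitesimal_coe.1 (hst 0) r hr] with j hj
    have hj : |s j 0 - t j 0| < r := hj
    change |Function.update (ξ j) i (s j 0) l - Function.update (ξ j) i (t j 0) l| < r
    by_cases hl : l = i
    · subst hl
      simpa only [Function.update_self] using hj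
    · simpa only [Function.update_of_ne hl, sub_self, abs_zero] using hr
  refine ⟨fun t ht => ?_, fun s hs t ht hst => ?_⟩
  · rw [happ]
    exact hφ.1 _ (hgrid t ht)
  · rw [happ, happ]
    exact hφ.2 _ (hgrid s hs) _ (hgrid t ht) (hnear s t hst)

theorem slice_mul_sub_mul {τ : Type*} [DecidableEq τ] (φ f m : Star U ((τ → ℝ) → ℝ))
    (ξ : Star U (τ → ℝ)) (i : τ) :
    slice (φ * f - φ * m) ξ i = slice φ ξ i * slice (f - m) ξ i := by
  rw [← mul_sub]
  generalize f - m = g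
  induction φ using Germ.inductionOn with | _ P
  induction g using Germ.inductionOn with | _ G
  induction ξ using Germ.inductionOn with | _ ξ
  rfl

theorem isUnlimitedNat_axis {τ : Type*} {N : Star U (τ → ℕ)} {i : τ}
    (hN : IsUnlimitedNat (coord N i)) :
    IsUnlimitedNat (coord (axis N i) 0) := by
  induction N using Germ.inductionOn with | _ n
  exact hN

/-- The product of a noise of mean `m` by a function `φ` of class `S⁰` is a noise of mean
`φ * m`. -/
theorem IsNoise.classS0_mul {φ f m : Star U ((σ → ℝ) → ℝ)}
    (hN : ∀ i, IsUnlimitedNat (coord N i)) (hf : IsNoise N f m) (hφ : IsClassS0 N φ) :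
    IsNoise N (φ * f) (φ * m) := by
  obtain ⟨hm, hint, hosc⟩ := hf
  refine ⟨hm.classS0_mul hφ, hint.limited_mul hφ.1, fun i ξ hξ => ?_⟩
  rw [slice_mul_sub_mul]
  exact (hosc i ξ hξ).classS0_mul (isUnlimitedNat_axis (hN i)) (hφ.slice hξ i)

end Slices

end NonstandardNoise

end

theorem proposition1 {J : Type*} (U : Ultrafilter J) (D : ℕ)
    (N : NonstandardNoise.Star U (Fin (D + 1) → ℕ))
    (hN : ∀ i, NonstandardNoise.IsUnlimitedNat (NonstandardNoise.coord N i))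
    (φ : NonstandardNoise.Star U ((Fin (D + 1) → ℝ) → ℝ))
    (hφ : NonstandardNoise.IsClassS1 N φ)
    (f : NonstandardNoise.Star U ((Fin (D + 1) → ℝ) → ℝ)) :
    (∀ m : NonstandardNoise.Star U ((Fin (D + 1) → ℝ) → ℝ),
      NonstandardNoise.IsNoise N f m → NonstandardNoise.IsNoise N (φ * f) (φ * m)) ∧
    (NonstandardNoise.IsZeroMean N f → NonstandardNoise.IsZeroMean N (φ * f)) := by
  have h : ∀ m : NonstandardNoise.Star U ((Fin (D + 1) → ℝ) → ℝ),
      NonstandardNoise.IsNoise N f m → NonstandardNoise.IsNoise N (φ * f) (φ * m) :=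
    fun m hm => hm.classS0_mul hN hφ.isClassS0
  refine ⟨h, fun hf => ?_⟩
  have h₀ := h 0 hf
  rwa [mul_zero] at h₀
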